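/- For a Dirichlet character $\chi$ modulo $N$, define the generalized Bernoulli numbers and polynomials by $$\sum_{a=1}^{N}\frac{\chi(a)\,t\,e^{at}}{e^{Nt}-1}=\sum_{n=0}^\infty B_{n,\chi}\frac{t^n}{n!},\qquad B_{n,\chi}(x)=\sum_{k=0}^n\binom nk B_{k,\chi}\,x^{n-k}.$$ For a sequence $(c_k)_{k\ge0}$ and $n\ge 0$ let $H_n(c_k)=\det\,(c_{i+j})_{0\le i,j\le n}$. Let $\chi_{8,1},\chi_{8,2}$ be the characters modulo $8$ whose values at $1,3,5,7$ are $1,-1,-1,1$ and $1,1,-1,-1$, respectively, and let $\chi_{12,1},\chi_{12,2}$ be the characters modulo $12$ whose values at $1,5,7,11$ are $1,-1,-1,1$ and $1,1,-1,-1$, respectively. Let $q=4$ or $q=6$, set $\widetilde q:=(q-2)/q$, let $x$ be a complex number, and for $k\ge0$ put $$b_k^{(1)}:=\frac{1}{k+1}B_{k+1,\chi_{2q,1}}(x),\qquad b_k^{(2)}:=\frac{1}{k+1}B_{k+1,\chi_{2q,2}}(x).$$ Here $B_{n,\chi_{2q,i}}$ is formed with $N=2q$. Then for all integers $m\ge 0$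 we have $H_{2m}\big(b_k^{(1)}\big)=0$ and \begin{align*} H_{2m+1}\big(b_k^{(1)}\big)&=(-1)^{m+1}\left(\frac{q-2}{2}\,q^{2m}\right)^{2m+2}\prod_{\ell=1}^m\left(\frac{\ell^2}{4}\left(\widetilde q^{\,2}-(2\ell)^2\right)\right)^{2(m+1-\ell)},\\ H_{2m}\big(b_k^{(2)}\big)&=(-1)^{m+1}\frac{q^{2m(2m+1)}}{m!^2}\prod_{\ell=1}^m\left(\frac{\ell^2}{4}\left(\widetilde q^{\,2}-(2\ell-1)^2\right)\right)^{2(m+1-\ell)},\\ H_{2m+1}\big(b_k^{(2)}\big)&=\left(\frac12\,q^{2m+1}\right)^{2m+2}\prod_{\ell=0}^m\frac{\ell!^4}{16^\ell}\left(\widetilde q^{\,2}-(2\ell+1)^2\right)^{2(m-\ell)+1}. \end{align*} -/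

import Mathlib

/-- The `n`-th Hankel determinant `H_n(c) = det (c_{i+j})_{0 ≤ i, j ≤ n}`,
of a matrix with `n + 1` rows and columns. -/
def hankelDet {R : Type*} [CommRing R] (c : ℕ → R) (n : ℕ) : R :=
  Matrix.det (Matrix.of fun i j : Fin (n + 1) => c ((i : ℕ) + (j : ℕ)))

/-- The formal power series `e^{at}` over `ℂ`. -/
noncomputable def expSeries (a : ℕ) : PowerSeries ℂ :=
  PowerSeries.rescale (a : ℂ) (PowerSeries.exp ℂ)

/-- The formal power series `(e^{Nt} - 1) / t` over `ℂ`; its constant coefficient is `N`. -/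
noncomputable def expSubOneDivX (N : ℕ) : PowerSeries ℂ :=
  PowerSeries.mk fun n => (N : ℂ) ^ (n + 1) / (Nat.factorial (n + 1) : ℂ)

theorem X_mul_expSubOneDivX (N : ℕ) :
    PowerSeries.X * expSubOneDivX N = expSeries N - 1 := by
  ext n
  cases n with
  | zero =>
    rw [PowerSeries.coeff_zero_X_mul, map_sub, expSeries, PowerSeries.coeff_rescale]
    simp
  | succ n =>
    rw [PowerSeries.coeff_succ_X_mul]
    simp [expSeries, expSubOneDivX, PowerSeries.coeff_exp, PowerSeries.coeff_one, div_eq_mul_inv]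

/-- The generalized Bernoulli number `B_{n,χ}` of a Dirichlet character `χ` modulo `N ≥ 1`:
`n!` times the coefficient of `t ^ n` in `∑_{a=1}^{N} χ(a) t e^{at} / (e^{Nt} - 1)`. -/
noncomputable def genBernoulli {N : ℕ} (χ : DirichletCharacter ℂ N) (n : ℕ) : ℂ :=
  (Nat.factorial n : ℂ) * PowerSeries.coeff n
    ((∑ a ∈ Finset.Icc 1 N, PowerSeries.C (χ (a : ZMod N)) * expSeries a) *
      (expSubOneDivX N)⁻¹)

/-- The generating function of the generalized Bernoulli numbers, without denominators. -/
theorem genBernoulli_generating_function {N : ℕ} (hN : N ≠ 0) (χ : DirichletCharacter ℂ N) :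
    (PowerSeries.mk fun n => genBernoulli χ n / (Nat.factorial n : ℂ)) * (expSeries N - 1) =
      ∑ a ∈ Finset.Icc 1 N, PowerSeries.C (χ (a : ZMod N)) * PowerSeries.X * expSeries a := by
  have h0 : PowerSeries.constantCoeff (expSubOneDivX N) ≠ 0 := by
    simpa [expSubOneDivX, ← PowerSeries.coeff_zero_eq_constantCoeff_apply] using hN
  have h1 : (PowerSeries.mk fun n => genBernoulli χ n / (Nat.factorial n : ℂ)) =
      (∑ a ∈ Finset.Icc 1 N, PowerSeries.C (χ (a : ZMod N)) * expSeries a) *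
        (expSubOneDivX N)⁻¹ := by
    ext n
    rw [PowerSeries.coeff_mk, genBernoulli, mul_div_cancel_left₀]
    exact_mod_cast Nat.factorial_ne_zero n
  rw [h1, ← X_mul_expSubOneDivX, mul_comm PowerSeries.X, ← mul_assoc,
    mul_assoc _ _ (expSubOneDivX N), PowerSeries.inv_mul_cancel _ h0, mul_one, Finset.sum_mul]
  exact Finset.sum_congr rfl fun a _ => by ring

/-- The generalized Bernoulli polynomial
`B_{n,χ}(x) = ∑_{k=0}^{n} (n choose k) B_{k,χ} x^{n-k}`. -/
noncomputable def genBernoulliPoly {N : ℕ} (χ : DirichletCharacter ℂ N) (n : ℕ) :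
    Polynomial ℂ :=
  ∑ k ∈ Finset.range (n + 1),
    Polynomial.C ((Nat.choose n k : ℂ) * genBernoulli χ k) * Polynomial.X ^ (n - k)

/-- The character modulo 8 with values `1, -1, -1, 1` at `1, 3, 5, 7`. -/
def chiInt81 : MulChar (ZMod 8) ℤ where
  toFun a :=
    match a with
    | 0 | 2 | 4 | 6 => 0
    | 1 | 7 => 1
    | 3 | 5 => -1
  map_one' := rfl
  map_mul' := by decide
  map_nonunit' := by decide

/-- The character modulo 8 with values `1, 1, -1, -1` at `1, 3, 5, 7`. -/
def chiInt82 : MulChar (ZMod 8) ℤ where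
  toFun a :=
    match a with
    | 0 | 2 | 4 | 6 => 0
    | 1 | 3 => 1
    | 5 | 7 => -1
  map_one' := rfl
  map_mul' := by decide
  map_nonunit' := by decide

/-- The character modulo 12 with values `1, -1, -1, 1` at `1, 5, 7, 11`. -/
def chiInt121 : MulChar (ZMod 12) ℤ where
  toFun a :=
    match a with
    | 0 | 2 | 3 | 4 | 6 | 8 | 9 | 10 => 0
    | 1 | 11 => 1
    | 5 | 7 => -1
  map_one' := rfl
  map_mul' := by decide
  map_nonunit' := by decide

/-- The character modulo 12 with values `1, 1, -1, -1` at `1, 5, 7, 11`. -/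
def chiInt122 : MulChar (ZMod 12) ℤ where
  toFun a :=
    match a with
    | 0 | 2 | 3 | 4 | 6 | 8 | 9 | 10 => 0
    | 1 | 5 => 1
    | 7 | 11 => -1
  map_one' := rfl
  map_mul' := by decide
  map_nonunit' := by decide

/-- The complex Dirichlet character `χ_{2q,1}` modulo `2q` for `q = 4` and `q = 6`
(for other `q`, which are never used, the trivial character). -/
noncomputable def chiOne : (q : ℕ) → DirichletCharacter ℂ (2 * q)
  | 4 => MulChar.ringHomComp chiInt81 (Int.castRingHom ℂ)
  | 6 => MulChar.ringHomComp chiInt121 (Int.castRingHom ℂ)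
  | _ => 1

/-- The complex Dirichlet character `χ_{2q,2}` modulo `2q` for `q = 4` and `q = 6`
(for other `q`, which are never used, the trivial character). -/
noncomputable def chiTwo : (q : ℕ) → DirichletCharacter ℂ (2 * q)
  | 4 => MulChar.ringHomComp chiInt82 (Int.castRingHom ℂ)
  | 6 => MulChar.ringHomComp chiInt122 (Int.castRingHom ℂ)
  | _ => 1

/-- The sequence `b_k = B_{k+1,χ}(x) / (k+1)`, `k = 0, 1, 2, …`. -/
noncomputable def bSeq {N : ℕ} (χ : DirichletCharacter ℂ N) (x : ℂ) (k : ℕ) : ℂ :=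
  (genBernoulliPoly χ (k + 1)).eval x / ((k : ℂ) + 1)

/-- `q̃ = (q - 2) / q`. -/
noncomputable def qTilde (q : ℕ) : ℂ := ((q : ℂ) - 2) / (q : ℂ)

/-! The four characters satisfy `∑ χ(a) e^{at} = (e^t + ε e^{(q-1)t}) (1 - e^{qt})` with `ε = ∓1`.
So at `x = 0` the `b_k` have exponential generating function `-(e^t + ε e^{(q-1)t}) / (e^{qt} + 1)`.
With `u = qt` and `s = 1/2 - 1/q = q̃/2` this is `-(e^{-su} + ε e^{su}) / (e^{u/2} + e^{-u/2})`.
Hence `b_k = q^k L((X + x/q)^k)` for a functional `L` determined by its values on `p(X + 1/2) + p(X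
- 1/2)` (`exists_midpointFunctional`, `bSeq_eq`). Hankel determinants ignore the translation, which
removes `x`.

Half of the moments of `L` vanish, the odd ones for `ε = 1` and the even ones for `ε = -1`, so
sorting indices by parity reduces to Hankel determinants in `X²`. There `L`, possibly weighted by
`X` or `X²`, is a continuous dual Hahn functional: it has Pochhammer values on the products `∏ (X -
(a+j)²)` (`apply_even`, `apply_odd`). A Gram matrix in two such bases with different parameters is,
up to row and column factors, the Hankel matrix of `(-1)^k (a+b)_k`, which is evaluated by
Vandermonde (`hankelSizeDet_dualHahn`). What remains is rearranging products. -/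

/-! ### Gram determinants, translation and scaling of Hankel determinants -/

open Polynomial in
/-- The Gram determinant of two families of monic polynomials with respect to a linear functional
is the Hankel determinant of its moments. -/
theorem det_gram_monic {R : Type*} [CommRing R] (L : R[X] →ₗ[R] R) (p r : ℕ → R[X])
    (hp : ∀ i, (p i).natDegree = i) (hpm : ∀ i, (p i).Monic)
    (hr : ∀ i, (r i).natDegree = i) (hrm : ∀ i, (r i).Monic) (n : ℕ) :
    (Matrix.of fun i j : Fin n => L (p i * r j)).det =
      (Matrix.of fun i j : Fin n => L (X ^ ((i : ℕ) + j))).det := by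
  have key : (Matrix.of fun i j : Fin n => L (p i * r j)) =
      (Matrix.of fun i j : Fin n => (p j).coeff i).transpose *
        (Matrix.of fun i j : Fin n => L (X ^ ((i : ℕ) + j))) *
        (Matrix.of fun i j : Fin n => (r j).coeff i) := by
    have expand : ∀ (s : ℕ → R[X]), (∀ i, (s i).natDegree = i) → ∀ i : Fin n,
        s i = ∑ k : Fin n, C ((s i).coeff k) * X ^ (k : ℕ) := by
      intro s hs i
      conv_lhs => rw [(s i).as_sum_range_C_mul_X_pow' (n := n) (by rw [hs]; exact i.2)]
      rw [Fin.sum_univ_eq_sum_range (fun k => C ((s i).coeff k) * X ^ k)]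
    ext i j
    simp only [Matrix.of_apply, Matrix.mul_apply, Matrix.transpose_apply]
    conv_lhs => rw [expand p hp i, expand r hr j]
    rw [Finset.sum_mul_sum]
    simp only [map_sum, Finset.sum_mul]
    conv_rhs => rw [Finset.sum_comm]
    refine Finset.sum_congr rfl fun k _ => Finset.sum_congr rfl fun l _ => ?_
    have : C ((p i).coeff k) * X ^ (k : ℕ) * (C ((r j).coeff l) * X ^ (l : ℕ)) =
        ((p i).coeff k * (r j).coeff l) • X ^ ((k : ℕ) + l) := by
      rw [smul_eq_C_mul, C_mul, pow_add]; ring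
    rw [this, map_smul, smul_eq_mul]; ring
  rw [key, Matrix.det_mul, Matrix.det_mul, Matrix.det_transpose,
    Matrix.det_matrixOfPolynomials (fun j : Fin n => p j) (fun i => hp i) (fun i => hpm i),
    Matrix.det_matrixOfPolynomials (fun j : Fin n => r j) (fun i => hr i) (fun i => hrm i)]
  ring

/-- The determinant of the `n × n` Hankel matrix of a sequence. -/
def hankelSizeDet {R : Type*} [CommRing R] (c : ℕ → R) (n : ℕ) : R :=
  (Matrix.of fun i j : Fin n => c ((i : ℕ) + (j : ℕ))).det

theorem hankelDet_eq_hankelSizeDet {R : Type*} [CommRing R] (c : ℕ → R) (n : ℕ) :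
    hankelDet c n = hankelSizeDet c (n + 1) := rfl

open Polynomial in
theorem hankelSizeDet_translate {R : Type*} [CommRing R] [Nontrivial R] (L : R[X] →ₗ[R] R)
    (x : R) (n : ℕ) :
    hankelSizeDet (fun k => L ((X + C x) ^ k)) n = hankelSizeDet (fun k => L (X ^ k)) n := by
  have h := det_gram_monic L (fun i => (X + C x) ^ i) (fun i => (X + C x) ^ i)
    (fun i => natDegree_pow_X_add_C i x) (fun i => (monic_X_add_C x).pow i)
    (fun i => natDegree_pow_X_add_C i x) (fun i => (monic_X_add_C x).pow i) n
  simp only [← pow_add] at h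
  exact h

theorem hankelSizeDet_const_mul {R : Type*} [CommRing R] (c : ℕ → R) (r : R) (n : ℕ) :
    hankelSizeDet (fun k => r * c k) n = r ^ n * hankelSizeDet c n := by
  have : (Matrix.of fun i j : Fin n => r * c ((i : ℕ) + (j : ℕ))) =
      r • Matrix.of fun i j : Fin n => c ((i : ℕ) + (j : ℕ)) := by
    ext i j; simp
  rw [hankelSizeDet, hankelSizeDet, this, Matrix.det_smul, Fintype.card_fin]

theorem hankelSizeDet_pow_mul {R : Type*} [CommRing R] (c : ℕ → R) (r : R) (n : ℕ) :
    hankelSizeDet (fun k => r ^ k * c k) n = r ^ (n * (n - 1)) * hankelSizeDet c n := by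
  have h1 := Matrix.det_mul_row (fun i : Fin n => r ^ (i : ℕ))
    (Matrix.of fun i j : Fin n => c ((i : ℕ) + (j : ℕ)))
  have h2 := Matrix.det_mul_column (fun i : Fin n => r ^ (i : ℕ))
    (Matrix.of fun i j : Fin n => r ^ (j : ℕ) * c ((i : ℕ) + (j : ℕ)))
  have e : (Matrix.of fun i j : Fin n => r ^ ((i : ℕ) + (j : ℕ)) * c ((i : ℕ) + (j : ℕ))) =
      Matrix.of fun i j : Fin n => r ^ (i : ℕ) *
        (Matrix.of fun i j : Fin n => r ^ (j : ℕ) * c ((i : ℕ) + (j : ℕ))) i j := by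
    ext i j; simp [pow_add, mul_assoc]
  have hs : ∏ i : Fin n, r ^ (i : ℕ) = r ^ (∑ i ∈ Finset.range n, i) := by
    rw [Finset.prod_pow_eq_pow_sum, Fin.sum_univ_eq_sum_range (fun i => i)]
  simp only [Matrix.of_apply] at h1 h2
  rw [hankelSizeDet, hankelSizeDet, e]
  simp only [Matrix.of_apply]
  rw [h2, h1, hs, ← mul_assoc, ← pow_add, ← mul_two, Finset.sum_range_id_mul_two]

/-- Replacing `c k` by `(-1)^k c k` preserves every Hankel determinant, but here it is negation of
`c`, which flips the sign in odd size. -/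
theorem hankelSizeDet_eq_zero_of_odd (c : ℕ → ℂ) (hc : ∀ k, c (2 * k) = 0) (m : ℕ) :
    hankelSizeDet c (2 * m + 1) = 0 := by
  have h1 := hankelSizeDet_pow_mul c (-1) (2 * m + 1)
  have h2 := hankelSizeDet_const_mul c (-1) (2 * m + 1)
  have e : (fun k => (-1 : ℂ) ^ k * c k) = fun k => -1 * c k := by
    ext k
    rcases Nat.even_or_odd' k with ⟨j, rfl | rfl⟩
    · simp [hc]
    · simp [pow_succ, pow_mul]
  rw [e, h2] at h1
  simp only [Nat.add_sub_cancel, pow_succ, pow_mul, mul_comm (2 * m + 1)] at h1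
  norm_num at h1
  linear_combination -h1 / 2

/-! ### Splitting by parity of the indices -/

/-- The even indices followed by the odd ones. -/
noncomputable def evenOddEquiv (n k N : ℕ) (hN : N = n + k) (h1 : k ≤ n) (h2 : n ≤ k + 1) :
    Fin n ⊕ Fin k ≃ Fin N :=
  Equiv.ofBijective
    (Sum.elim (fun i => ⟨2 * i, by have := i.2; omega⟩) (fun i => ⟨2 * i + 1, by have := i.2; omega⟩))
    (by
      rw [Fintype.bijective_iff_injective_and_card]
      refine ⟨?_, by simp [hN]⟩
      rintro (i | i) (j | j) h <;> simp [Fin.ext_iff] at h ⊢ <;> omega)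

theorem hankelSizeDet_eq_det_fromBlocks {R : Type*} [CommRing R] (c : ℕ → R) (n k N : ℕ)
    (hN : N = n + k) (h1 : k ≤ n) (h2 : n ≤ k + 1) :
    hankelSizeDet c N = (Matrix.fromBlocks
      (Matrix.of fun i j : Fin n => c (2 * ((i : ℕ) + j)))
      (Matrix.of fun (i : Fin n) (j : Fin k) => c (2 * ((i : ℕ) + j) + 1))
      (Matrix.of fun (i : Fin k) (j : Fin n) => c (2 * ((i : ℕ) + j) + 1))
      (Matrix.of fun i j : Fin k => c (2 * ((i : ℕ) + j) + 2))).det := by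
  rw [hankelSizeDet, ← Matrix.det_submatrix_equiv_self (evenOddEquiv n k N hN h1 h2)]
  congr 1
  ext (i | i) (j | j) <;> simp [evenOddEquiv] <;> congr 1 <;> ring

theorem hankelSizeDet_of_even {R : Type*} [CommRing R] (c : ℕ → R)
    (hc : ∀ k, c (2 * k + 1) = 0) (n k N : ℕ) (hN : N = n + k) (h1 : k ≤ n) (h2 : n ≤ k + 1) :
    hankelSizeDet c N =
      hankelSizeDet (fun i => c (2 * i)) n * hankelSizeDet (fun i => c (2 * i + 2)) k := by
  rw [hankelSizeDet_eq_det_fromBlocks c n k N hN h1 h2]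
  simp only [hc]
  exact Matrix.det_fromBlocks_zero₂₁ _ _ _

theorem det_fromBlocks_antidiagonal {R n : Type*} [CommRing R] [Fintype n] [DecidableEq n]
    (A B : Matrix n n R) :
    (Matrix.fromBlocks 0 A B 0).det = (-1) ^ Fintype.card n * (A.det * B.det) := by
  have hswap : (Matrix.fromBlocks 0 1 1 0 : Matrix (n ⊕ n) (n ⊕ n) R).det =
      (-1) ^ Fintype.card n := by
    -- A unipotent factor puts an identity block in the corner; its Schur complement is `-1`, which
    -- gives the sign.
    have h : (Matrix.fromBlocks 1 1 0 1 : Matrix (n ⊕ n) (n ⊕ n) R) *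
        Matrix.fromBlocks 0 1 1 0 = Matrix.fromBlocks 1 1 1 0 := by
      simp [Matrix.fromBlocks_multiply]
    have := congrArg Matrix.det h
    rw [Matrix.det_mul, Matrix.det_fromBlocks_zero₂₁, Matrix.det_fromBlocks_one₁₁] at this
    simpa [Matrix.det_neg] using this
  have h : (Matrix.fromBlocks 0 A B 0) =
      Matrix.fromBlocks A 0 0 B * (Matrix.fromBlocks 0 1 1 0 : Matrix (n ⊕ n) (n ⊕ n) R) := by
    simp [Matrix.fromBlocks_multiply]
  rw [h, Matrix.det_mul, Matrix.det_fromBlocks_zero₂₁, hswap, mul_comm]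

theorem hankelSizeDet_of_odd {R : Type*} [CommRing R] (c : ℕ → R)
    (hc : ∀ k, c (2 * k) = 0) (n : ℕ) :
    hankelSizeDet c (2 * n) = (-1) ^ n * hankelSizeDet (fun i => c (2 * i + 1)) n ^ 2 := by
  rw [hankelSizeDet_eq_det_fromBlocks c n n (2 * n) (two_mul n) le_rfl (by omega)]
  have hc' : ∀ k, c (2 * k + 2) = 0 := fun k => hc (k + 1)
  simp only [hc, hc']
  have := det_fromBlocks_antidiagonal (Matrix.of fun i j : Fin n => c (2 * ((i : ℕ) + j) + 1))
    (Matrix.of fun i j : Fin n => c (2 * ((i : ℕ) + j) + 1))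
  rw [Fintype.card_fin, ← sq] at this
  exact this

/-! ### Laguerre and continuous dual Hahn functionals -/

/-- The Hankel determinant of the moments `(α)_k` of the Laguerre weight. -/
theorem hankelSizeDet_ascPochhammer (α : ℂ) (n : ℕ) :
    hankelSizeDet (fun k => (ascPochhammer ℂ k).eval α) n =
      ∏ i ∈ Finset.range n, ((Nat.factorial i : ℂ) * (ascPochhammer ℂ i).eval α) := by
  -- Once the row factor `(α)_i` is pulled out, the entries are monic polynomials of degree `j` at
  -- the nodes `α + i`: a Vandermonde determinant.
  have hsplit : ∀ i j : ℕ, (ascPochhammer ℂ (i + j)).eval α =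
      (ascPochhammer ℂ i).eval α * (ascPochhammer ℂ j).eval (α + i) := by
    intro i j
    rw [← ascPochhammer_mul]
    simp
  have hdet := Matrix.det_eval_matrixOfPolynomials_eq_det_vandermonde
    (fun i : Fin n => (i : ℂ) + α) (fun j : Fin n => ascPochhammer ℂ j)
    (fun j => ascPochhammer_natDegree (S := ℂ) j) (fun j => monic_ascPochhammer ℂ j)
  rw [Matrix.det_vandermonde_add] at hdet
  have hv : (Matrix.vandermonde fun i : Fin n => (i : ℂ)).det =
      ∏ i ∈ Finset.range n, (Nat.factorial i : ℂ) := by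
    cases n with
    | zero => simp
    | succ n =>
      rw [Matrix.det_vandermonde_id_eq_superFactorial, Finset.prod_range_succ',
        Nat.factorial_zero, Nat.cast_one, mul_one]
      exact_mod_cast (Nat.prod_range_factorial_succ n).symm
  have h2 := Matrix.det_mul_column (fun i : Fin n => (ascPochhammer ℂ i).eval α)
    (Matrix.of fun i j : Fin n => (ascPochhammer ℂ j).eval ((i : ℂ) + α))
  simp only [Matrix.of_apply] at h2
  rw [hankelSizeDet]
  simp only [hsplit, add_comm α]
  rw [h2, ← hdet, hv, Fin.prod_univ_eq_prod_range (fun i => (ascPochhammer ℂ i).eval α),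
    Finset.prod_mul_distrib, mul_comm]
open Polynomial in
/-- The monic polynomials `∏_{j<n} (X - (a+j)²)`, up to sign the natural expansion basis of the
continuous dual Hahn polynomials. -/
noncomputable def dualHahnBasis (a : ℂ) (n : ℕ) : ℂ[X] :=
  ∏ j ∈ Finset.range n, (X - C ((a + j) ^ 2))

theorem dualHahnBasis_monic (a : ℂ) (n : ℕ) : (dualHahnBasis a n).Monic :=
  Polynomial.monic_prod_of_monic _ _ fun _ _ => Polynomial.monic_X_sub_C _

theorem dualHahnBasis_natDegree (a : ℂ) (n : ℕ) : (dualHahnBasis a n).natDegree = n := by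
  rw [dualHahnBasis, Polynomial.natDegree_prod_of_monic _ _ fun _ _ => Polynomial.monic_X_sub_C _]
  simp only [Polynomial.natDegree_X_sub_C, Finset.sum_const, Finset.card_range, smul_eq_mul,
    mul_one]

open Polynomial in
theorem dualHahnBasis_succ (a : ℂ) (n : ℕ) :
    dualHahnBasis a (n + 1) = dualHahnBasis a n * (X - C ((a + n) ^ 2)) :=
  Finset.prod_range_succ _ _

theorem dualHahnBasis_eval_sq (a s : ℂ) (n : ℕ) :
    (dualHahnBasis a n).eval (s ^ 2) =
      (-1) ^ n * (ascPochhammer ℂ n).eval (a + s) * (ascPochhammer ℂ n).eval (a - s) := by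
  induction n with
  | zero => simp [dualHahnBasis]
  | succ n ih =>
    rw [dualHahnBasis_succ, Polynomial.eval_mul, ih, ascPochhammer_succ_eval,
      ascPochhammer_succ_eval]
    simp only [Polynomial.eval_sub, Polynomial.eval_X, Polynomial.eval_C]
    ring

open Polynomial in
/-- The mixed moments of the continuous dual Hahn functional. -/
theorem dualHahn_mixed_moment (L : ℂ[X] →ₗ[ℂ] ℂ) (a b c K : ℂ)
    (hL : ∀ i, L (dualHahnBasis a i) =
      K * ((-1) ^ i * (ascPochhammer ℂ i).eval (a + b) * (ascPochhammer ℂ i).eval (a + c)))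
    (k i : ℕ) :
    L (dualHahnBasis a i * dualHahnBasis b k) =
      K * ((-1) ^ (i + k) * (ascPochhammer ℂ (i + k)).eval (a + b) *
        (ascPochhammer ℂ i).eval (a + c) * (ascPochhammer ℂ k).eval (b + c)) := by
  induction k generalizing i with
  | zero => simpa [dualHahnBasis] using hL i
  | succ k ih =>
    -- Trades a factor `X - (b+k)²` for `X - (a+i)²`. The values then combine because `(a+i)² -
    -- (b+k)² - (a+b+i+k)(a+c+i) = -(a+b+i+k)(b+c+k)`.
    have h : dualHahnBasis a i * dualHahnBasis b (k + 1) =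
        dualHahnBasis a (i + 1) * dualHahnBasis b k +
          ((a + i) ^ 2 - (b + k) ^ 2) • (dualHahnBasis a i * dualHahnBasis b k) := by
      rw [dualHahnBasis_succ, dualHahnBasis_succ, smul_eq_C_mul, C_sub]
      ring
    rw [h, map_add, map_smul, ih, ih, show i + 1 + k = i + k + 1 by ring,
      show i + (k + 1) = i + k + 1 by ring, ascPochhammer_succ_eval, ascPochhammer_succ_eval,
      ascPochhammer_succ_eval, smul_eq_mul]
    push_cast
    ring

open Polynomial in
/-- The Hankel determinant of the moments of the continuous dual Hahn functional. -/
theorem hankelSizeDet_dualHahn (L : ℂ[X] →ₗ[ℂ] ℂ) (a b c K : ℂ)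
    (hL : ∀ i, L (dualHahnBasis a i) =
      K * ((-1) ^ i * (ascPochhammer ℂ i).eval (a + b) * (ascPochhammer ℂ i).eval (a + c)))
    (n : ℕ) :
    hankelSizeDet (fun k => L (X ^ k)) n =
      K ^ n * ∏ i ∈ Finset.range n, ((Nat.factorial i : ℂ) * (ascPochhammer ℂ i).eval (a + b) *
        (ascPochhammer ℂ i).eval (a + c) * (ascPochhammer ℂ i).eval (b + c)) := by
  have hg := det_gram_monic L (dualHahnBasis a) (dualHahnBasis b) (dualHahnBasis_natDegree a)
    (dualHahnBasis_monic a) (dualHahnBasis_natDegree b) (dualHahnBasis_monic b) n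
  rw [hankelSizeDet, ← hg]
  -- Each entry is now `(a+c)_i (b+c)_j` times a function of `i + j` alone, whose Hankel determinant
  -- is the Laguerre one; the signs `(-1)^(i+j)` cancel.
  simp only [dualHahn_mixed_moment L a b c K hL]
  have h1 := hankelSizeDet_const_mul
    (fun k => (-1) ^ k * (ascPochhammer ℂ k).eval (a + b)) K n
  rw [hankelSizeDet_pow_mul, (Nat.even_mul_pred_self n).neg_one_pow, one_mul,
    hankelSizeDet_ascPochhammer, hankelSizeDet] at h1
  have h2 := Matrix.det_mul_row (fun j : Fin n => (ascPochhammer ℂ j).eval (b + c))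
    (Matrix.of fun i j : Fin n =>
      K * ((-1) ^ ((i : ℕ) + j) * (ascPochhammer ℂ (i + j)).eval (a + b)))
  have h3 := Matrix.det_mul_column (fun j : Fin n => (ascPochhammer ℂ j).eval (a + c))
    (Matrix.of fun i j : Fin n => (ascPochhammer ℂ j).eval (b + c) *
      (K * ((-1) ^ ((i : ℕ) + j) * (ascPochhammer ℂ (i + j)).eval (a + b))))
  simp only [Matrix.of_apply] at h2 h3
  rw [h2, h1, Fin.prod_univ_eq_prod_range (fun i => (ascPochhammer ℂ i).eval (a + c)),
    Fin.prod_univ_eq_prod_range (fun i => (ascPochhammer ℂ i).eval (b + c))] at h3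
  simp only [Finset.prod_mul_distrib] at h3 ⊢
  trans (∏ i ∈ Finset.range n, (ascPochhammer ℂ i).eval (a + c)) *
    ((∏ i ∈ Finset.range n, (ascPochhammer ℂ i).eval (b + c)) *
      (K ^ n * ((∏ i ∈ Finset.range n, (Nat.factorial i : ℂ)) *
        ∏ i ∈ Finset.range n, (ascPochhammer ℂ i).eval (a + b))))
  · rw [← h3]
    congr 1
    ext i j
    simp only [Matrix.of_apply]
    ring
  · ring

/-! ### Functionals given on midpoint sums -/

-- Since `(X + 1/2)² - (j + 1/2)² = (X - j)(X + j + 1)`, the shifted product telescopes to `∏ (X² -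
-- j²)` times `(X + n)/X`, and the other shift gives `(X - n)/X`. The two factors add up to 2.
open Polynomial in
theorem expand_dualHahnBasis_zero_shift (n : ℕ) :
    (expand ℂ 2 (dualHahnBasis (1 / 2) n)).comp (X + C (1 / 2)) +
      (expand ℂ 2 (dualHahnBasis (1 / 2) n)).comp (X - C (1 / 2)) =
        C 2 * expand ℂ 2 (dualHahnBasis 0 n) := by
  have h : ∀ n : ℕ,
      (expand ℂ 2 (dualHahnBasis (1 / 2) n)).comp (X + C (1 / 2)) * X =
        expand ℂ 2 (dualHahnBasis 0 n) * (X + C (n : ℂ)) ∧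
      (expand ℂ 2 (dualHahnBasis (1 / 2) n)).comp (X - C (1 / 2)) * X =
        expand ℂ 2 (dualHahnBasis 0 n) * (X - C (n : ℂ)) := by
    intro n
    have hC : (C (1 / 2 : ℂ)) * 2 = 1 := by rw [← C_ofNat, ← C_mul]; norm_num
    induction n with
    | zero => simp [dualHahnBasis]
    | succ n ih =>
      obtain ⟨h1, h2⟩ := ih
      simp only [dualHahnBasis_succ, map_mul (expand ℂ 2), map_sub (expand ℂ 2), expand_X,
        expand_C, mul_comp, sub_comp, pow_comp, X_comp, C_comp]
      simp only [C_add, C_pow, Nat.cast_add, Nat.cast_one, C_1, zero_add]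
      constructor
      · linear_combination ((X + C (1 / 2)) ^ 2 - (C (1 / 2) + C (n : ℂ)) ^ 2) * h1 +
          expand ℂ 2 (dualHahnBasis 0 n) * (X + C (n : ℂ)) * (X - C (n : ℂ)) * hC
      · linear_combination ((X - C (1 / 2)) ^ 2 - (C (1 / 2) + C (n : ℂ)) ^ 2) * h2 -
          expand ℂ 2 (dualHahnBasis 0 n) * (X - C (n : ℂ)) * (X + C (n : ℂ)) * hC
  obtain ⟨h1, h2⟩ := h n
  apply mul_right_cancel₀ (X_ne_zero (R := ℂ))
  rw [C_ofNat]
  linear_combination h1 + h2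

-- The same telescoping, with the extra factor `X` absorbed: the two shifts leave the cofactors `X ±
-- (n + 1/2)`, whose sum is `2X`.
open Polynomial in
theorem expand_dualHahnBasis_half_shift (n : ℕ) :
    (X * expand ℂ 2 (dualHahnBasis 1 n)).comp (X + C (1 / 2)) +
      (X * expand ℂ 2 (dualHahnBasis 1 n)).comp (X - C (1 / 2)) =
        C 2 * (X * expand ℂ 2 (dualHahnBasis (1 / 2) n)) := by
  have h : ∀ n : ℕ,
      (X * expand ℂ 2 (dualHahnBasis 1 n)).comp (X + C (1 / 2)) =
        expand ℂ 2 (dualHahnBasis (1 / 2) n) * (X + C (1 / 2) + C (n : ℂ)) ∧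
      (X * expand ℂ 2 (dualHahnBasis 1 n)).comp (X - C (1 / 2)) =
        expand ℂ 2 (dualHahnBasis (1 / 2) n) * (X - C (1 / 2) - C (n : ℂ)) := by
    intro n
    have hC : (C (1 / 2 : ℂ)) * 2 = 1 := by rw [← C_ofNat, ← C_mul]; norm_num
    induction n with
    | zero => simp [dualHahnBasis]
    | succ n ih =>
      obtain ⟨h1, h2⟩ := ih
      simp only [dualHahnBasis_succ, map_mul (expand ℂ 2), map_sub (expand ℂ 2), expand_X,
        expand_C, mul_comp, sub_comp, pow_comp, X_comp, C_comp] at h1 h2 ⊢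
      simp only [C_add, C_pow, Nat.cast_add, Nat.cast_one, C_1]
      constructor
      · linear_combination ((X + C (1 / 2)) ^ 2 - (1 + C (n : ℂ)) ^ 2) * h1 +
          expand ℂ 2 (dualHahnBasis (1 / 2) n) * (X + C (1 / 2) + C (n : ℂ)) *
            (X + C (1 / 2) + C (n : ℂ) + 1) * hC
      · linear_combination ((X - C (1 / 2)) ^ 2 - (1 + C (n : ℂ)) ^ 2) * h2 -
          expand ℂ 2 (dualHahnBasis (1 / 2) n) * (X - C (1 / 2) - C (n : ℂ)) *
            (X - C (1 / 2) - C (n : ℂ) - 1) * hC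
  obtain ⟨h1, h2⟩ := h n
  rw [h1, h2, C_ofNat]
  ring
open Polynomial in
theorem moment_eq_zero_of_dualHahnBasis (L : ℂ[X] →ₗ[ℂ] ℂ) (a : ℂ)
    (hL : ∀ i, L (dualHahnBasis a i) = 0) (k : ℕ) : L (X ^ k) = 0 := by
  have h : ∀ k i : ℕ, L (dualHahnBasis a i * X ^ k) = 0 := by
    intro k
    induction k with
    | zero => simpa using hL
    | succ k ih =>
      intro i
      have e : dualHahnBasis a i * X ^ (k + 1) = dualHahnBasis a (i + 1) * X ^ k +
          ((a + i) ^ 2) • (dualHahnBasis a i * X ^ k) := by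
        rw [dualHahnBasis_succ, smul_eq_C_mul]; ring
      rw [e, map_add, map_smul, ih, ih, smul_zero, add_zero]
  simpa [dualHahnBasis] using h k 0

theorem ascPochhammer_succ_eval_left (y : ℂ) (n : ℕ) :
    (ascPochhammer ℂ (n + 1)).eval y = y * (ascPochhammer ℂ n).eval (y + 1) := by
  rw [ascPochhammer_succ_left]; simp

open Polynomial in
/-- `L` is the functional whose exponential moment series is
`-(e^{-su} + ε e^{su}) / (e^{u/2} + e^{-u/2})`. -/
def IsMidpointFunctional (L : ℂ[X] →ₗ[ℂ] ℂ) (s ε : ℂ) : Prop :=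
  ∀ p : ℂ[X], L (p.comp (X + C (1 / 2)) + p.comp (X - C (1 / 2))) =
    -(p.eval (-s) + ε * p.eval s)

namespace IsMidpointFunctional

open Polynomial

variable {L : ℂ[X] →ₗ[ℂ] ℂ} {s ε : ℂ}

/-- The argument of `L` is half the midpoint sum of an even polynomial with known factors, so the
value is read off at `±s`. -/
theorem apply_even (h : IsMidpointFunctional L s ε) (i : ℕ) :
    L (expand ℂ 2 (dualHahnBasis 0 i)) =
      -(1 + ε) / 2 * ((-1) ^ i * (ascPochhammer ℂ i).eval (1 / 2 + s) *
        (ascPochhammer ℂ i).eval (1 / 2 - s)) := by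
  have h1 := h (expand ℂ 2 (dualHahnBasis (1 / 2) i))
  rw [expand_dualHahnBasis_zero_shift, ← smul_eq_C_mul, map_smul, expand_eval, expand_eval,
    neg_sq, dualHahnBasis_eval_sq, smul_eq_mul] at h1
  linear_combination h1 / 2

theorem apply_odd (h : IsMidpointFunctional L s ε) (i : ℕ) :
    L (X * expand ℂ 2 (dualHahnBasis (1 / 2) i)) =
      (1 - ε) / 2 * s * ((-1) ^ i * (ascPochhammer ℂ i).eval (1 + s) *
        (ascPochhammer ℂ i).eval (1 - s)) := by
  have h1 := h (X * expand ℂ 2 (dualHahnBasis 1 i))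
  rw [expand_dualHahnBasis_half_shift, ← smul_eq_C_mul, map_smul, eval_mul, eval_mul, eval_X,
    eval_X, expand_eval, expand_eval, neg_sq, dualHahnBasis_eval_sq, smul_eq_mul] at h1
  linear_combination h1 / 2

theorem moment_odd_eq_zero (h : IsMidpointFunctional L s 1) (k : ℕ) :
    L (X ^ (2 * k + 1)) = 0 := by
  have := moment_eq_zero_of_dualHahnBasis
    (L ∘ₗ LinearMap.mulLeft ℂ X ∘ₗ (expand ℂ 2).toLinearMap) (1 / 2)
    (fun i => by simpa using h.apply_odd i) k
  simpa [pow_succ', pow_mul] using this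

theorem moment_even_eq_zero (h : IsMidpointFunctional L s (-1)) (k : ℕ) :
    L (X ^ (2 * k)) = 0 := by
  have := moment_eq_zero_of_dualHahnBasis (L ∘ₗ (expand ℂ 2).toLinearMap) 0
    (fun i => by simpa using h.apply_even i) k
  simpa [pow_mul] using this

/-- Dual Hahn parameters `(0, 1/2 + s, 1/2 - s)`; the last two sum to 1, which yields the second
factorial. -/
theorem hankelSizeDet_moment_even (h : IsMidpointFunctional L s 1) (n : ℕ) :
    hankelSizeDet (fun k => L (X ^ (2 * k))) n =
      (-1) ^ n * ∏ i ∈ Finset.range n, ((Nat.factorial i : ℂ) ^ 2 *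
        ((ascPochhammer ℂ i).eval (1 / 2 + s) * (ascPochhammer ℂ i).eval (1 / 2 - s))) := by
  have h1 := hankelSizeDet_dualHahn (L ∘ₗ (expand ℂ 2).toLinearMap) 0 (1 / 2 + s) (1 / 2 - s) (-1)
    (fun i => by
      rw [zero_add, zero_add, LinearMap.comp_apply, AlgHom.toLinearMap_apply, h.apply_even]
      ring) n
  simp only [LinearMap.comp_apply, AlgHom.toLinearMap_apply, map_pow, expand_X, ← pow_mul] at h1
  rw [h1]
  congr 1
  refine Finset.prod_congr rfl fun i _ => ?_
  rw [show 1 / 2 + s + (1 / 2 - s) = 1 by ring, ascPochhammer_eval_one]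
  simp only [zero_add]
  ring

/-- The weight `X²` raises the parameter `0` to `1`, and the first Pochhammer factors become the
total mass. -/
theorem hankelSizeDet_moment_even_add_two (h : IsMidpointFunctional L s 1) (n : ℕ) :
    hankelSizeDet (fun k => L (X ^ (2 * k + 2))) n =
      ∏ i ∈ Finset.range n, ((Nat.factorial i : ℂ) ^ 2 *
        ((ascPochhammer ℂ (i + 1)).eval (1 / 2 + s) *
          (ascPochhammer ℂ (i + 1)).eval (1 / 2 - s))) := by
  have h1 := hankelSizeDet_dualHahn
    (L ∘ₗ LinearMap.mulLeft ℂ (X ^ 2) ∘ₗ (expand ℂ 2).toLinearMap) 1 (1 / 2 + s) (1 / 2 - s)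
    ((1 / 2 + s) * (1 / 2 - s))
    (fun i => by
      have e : ∀ i, X * dualHahnBasis 1 i = dualHahnBasis 0 (i + 1) := by
        intro i
        induction i with
        | zero => simp [dualHahnBasis]
        | succ i ih =>
          rw [dualHahnBasis_succ, ← mul_assoc, ih, dualHahnBasis_succ 0 (i + 1)]
          congr 4
          push_cast
          ring
      have h2 := h.apply_even (i + 1)
      rw [← e, map_mul, expand_X, ascPochhammer_succ_eval_left, ascPochhammer_succ_eval_left] at h2
      simp only [LinearMap.comp_apply, LinearMap.mulLeft_apply, AlgHom.toLinearMap_apply]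
      rw [h2, show 1 + (1 / 2 + s) = 1 / 2 + s + 1 by ring,
        show 1 + (1 / 2 - s) = 1 / 2 - s + 1 by ring]
      ring) n
  simp only [LinearMap.comp_apply, LinearMap.mulLeft_apply, AlgHom.toLinearMap_apply, map_pow,
    expand_X, ← pow_mul, ← pow_add, add_comm 2] at h1
  rw [h1, ← Finset.card_range n, ← Finset.prod_const, Finset.card_range, ← Finset.prod_mul_distrib]
  refine Finset.prod_congr rfl fun i _ => ?_
  rw [show 1 / 2 + s + (1 / 2 - s) = 1 by ring, ascPochhammer_eval_one,
    ascPochhammer_succ_eval_left, ascPochhammer_succ_eval_left,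
    show 1 + (1 / 2 + s) = 1 / 2 + s + 1 by ring, show 1 + (1 / 2 - s) = 1 / 2 - s + 1 by ring]
  ring

/-- The weight `X` gives parameters `(1/2, 1/2 + s, 1/2 - s)` and total mass `s`. -/
theorem hankelSizeDet_moment_odd (h : IsMidpointFunctional L s (-1)) (n : ℕ) :
    hankelSizeDet (fun k => L (X ^ (2 * k + 1))) n =
      s ^ n * ∏ i ∈ Finset.range n, ((Nat.factorial i : ℂ) ^ 2 *
        ((ascPochhammer ℂ i).eval (1 + s) * (ascPochhammer ℂ i).eval (1 - s))) := by
  have h1 := hankelSizeDet_dualHahn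
    (L ∘ₗ LinearMap.mulLeft ℂ X ∘ₗ (expand ℂ 2).toLinearMap) (1 / 2) (1 / 2 + s) (1 / 2 - s) s
    (fun i => by
      have h2 := h.apply_odd i
      simp only [LinearMap.comp_apply, LinearMap.mulLeft_apply, AlgHom.toLinearMap_apply]
      rw [h2, show 1 / 2 + (1 / 2 + s) = 1 + s by ring, show 1 / 2 + (1 / 2 - s) = 1 - s by ring]
      ring) n
  simp only [LinearMap.comp_apply, LinearMap.mulLeft_apply, AlgHom.toLinearMap_apply, map_pow,
    expand_X, ← pow_mul, ← pow_succ'] at h1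
  rw [h1]
  congr 1
  refine Finset.prod_congr rfl fun i _ => ?_
  rw [show 1 / 2 + s + (1 / 2 - s) = 1 by ring, ascPochhammer_eval_one,
    show 1 / 2 + (1 / 2 + s) = 1 + s by ring, show 1 / 2 + (1 / 2 - s) = 1 - s by ring]
  ring

end IsMidpointFunctional
-- From character sums to midpoint functionals
theorem expSeries_eq_pow (a : ℕ) : expSeries a = PowerSeries.exp ℂ ^ a :=
  (PowerSeries.exp_pow_eq_rescale_exp a).symm

/-- The twisted exponential sum `∑ χ(a) e^{at}` factors as for the characters modulo `8` and `12`. -/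
def HasFactorization {q : ℕ} (χ : DirichletCharacter ℂ (2 * q)) (ε : ℂ) : Prop :=
  ∑ a ∈ Finset.Icc 1 (2 * q), PowerSeries.C (χ (a : ZMod (2 * q))) * expSeries a =
    (expSeries 1 + PowerSeries.C ε * expSeries (q - 1)) * (1 - expSeries q)

namespace HasFactorization

variable {q : ℕ} {χ : DirichletCharacter ℂ (2 * q)} {ε : ℂ}

/-- The factor `1 - e^{qt}` cancels against `e^{2qt} - 1 = (e^{qt} - 1)(e^{qt} + 1)`. -/
theorem generating_function (h : HasFactorization χ ε) (hq : q ≠ 0) :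
    (PowerSeries.mk fun n => genBernoulli χ n / (Nat.factorial n : ℂ)) * (expSeries q + 1) =
      -(PowerSeries.X * (expSeries 1 + PowerSeries.C ε * expSeries (q - 1))) := by
  have h1 := genBernoulli_generating_function (N := 2 * q) (by omega) χ
  have h2 : ∑ a ∈ Finset.Icc 1 (2 * q), PowerSeries.C (χ (a : ZMod (2 * q))) * PowerSeries.X *
      expSeries a = PowerSeries.X * ((expSeries 1 + PowerSeries.C ε * expSeries (q - 1)) *
        (1 - expSeries q)) := by
    rw [← h, Finset.mul_sum]
    exact Finset.sum_congr rfl fun a _ => by ring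
  have h3 : expSeries (2 * q) = expSeries q ^ 2 := by
    rw [expSeries_eq_pow, expSeries_eq_pow, ← pow_mul, mul_comm]
  have hne : expSeries q - 1 ≠ 0 := by
    intro h0
    have := congrArg (PowerSeries.coeff 1) h0
    simp [expSeries, PowerSeries.coeff_rescale, PowerSeries.coeff_exp, PowerSeries.coeff_one,
      hq] at this
  rw [h2, h3] at h1
  apply mul_right_cancel₀ hne
  linear_combination h1

theorem genBernoulli_zero (h : HasFactorization χ ε) (hq : q ≠ 0) : genBernoulli χ 0 = 0 := by
  have := congrArg (PowerSeries.coeff 0) (h.generating_function hq)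
  rw [map_neg, PowerSeries.coeff_zero_X_mul, PowerSeries.coeff_zero_eq_constantCoeff_apply,
    map_mul] at this
  have e : PowerSeries.constantCoeff (expSeries q) = 1 := by
    rw [← PowerSeries.coeff_zero_eq_constantCoeff_apply, expSeries, PowerSeries.coeff_rescale]
    simp
  have e0 : PowerSeries.constantCoeff
      (PowerSeries.mk fun n => genBernoulli χ n / (Nat.factorial n : ℂ)) = genBernoulli χ 0 := by
    rw [← PowerSeries.coeff_zero_eq_constantCoeff_apply, PowerSeries.coeff_mk]
    simp
  rw [map_add, e, map_one, e0] at this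
  linear_combination this / 2

/-- This is `k!` times the coefficient of `t^(k+1)` in the generating function identity; the term
with `B_{0,χ} = 0` drops out. -/
theorem recurrence (h : HasFactorization χ ε) (hq : q ≠ 0) (k : ℕ) :
    ∑ j ∈ Finset.range (k + 1), (k.choose j : ℂ) * (genBernoulli χ (j + 1) / ((j : ℂ) + 1)) *
        (q : ℂ) ^ (k - j) + genBernoulli χ (k + 1) / ((k : ℂ) + 1) =
      -(1 + ε * ((q : ℂ) - 1) ^ k) := by
  have h1 := congrArg (PowerSeries.coeff (k + 1)) (h.generating_function hq)
  rw [mul_add, mul_one, map_add, PowerSeries.coeff_mul, map_neg, PowerSeries.coeff_succ_X_mul,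
    Finset.Nat.sum_antidiagonal_eq_sum_range_succ_mk, Finset.sum_range_succ'] at h1
  simp only [PowerSeries.coeff_mk, h.genBernoulli_zero hq, zero_div, zero_mul, add_zero, map_add,
    PowerSeries.coeff_C_mul, expSeries, PowerSeries.coeff_rescale, PowerSeries.coeff_exp,
    Nat.cast_one, one_pow, Nat.cast_sub (Nat.one_le_iff_ne_zero.mpr hq), Nat.add_sub_add_right,
    map_div₀, map_one, map_natCast] at h1
  have hk : (k.factorial : ℂ) ≠ 0 := by exact_mod_cast k.factorial_ne_zero
  have hk1 : (k : ℂ) + 1 ≠ 0 := by exact_mod_cast k.succ_ne_zero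
  have e1 : (k.factorial : ℂ) * (genBernoulli χ (k + 1) / ((k + 1).factorial : ℂ)) =
      genBernoulli χ (k + 1) / ((k : ℂ) + 1) := by
    rw [Nat.factorial_succ]; push_cast; field_simp
  have e2 : (k.factorial : ℂ) * -(1 * (1 / (k.factorial : ℂ)) +
      ε * (((q : ℂ) - 1) ^ k * (1 / (k.factorial : ℂ)))) = -(1 + ε * ((q : ℂ) - 1) ^ k) := by
    field_simp
  rw [← e1, ← e2, ← h1, mul_add, Finset.mul_sum]
  congr 1
  refine Finset.sum_congr rfl fun j hj => ?_
  have hj' : j ≤ k := by simpa [Nat.lt_succ_iff] using hj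
  have hj1 : (j : ℂ) + 1 ≠ 0 := by exact_mod_cast j.succ_ne_zero
  have hjf : (j.factorial : ℂ) ≠ 0 := by exact_mod_cast j.factorial_ne_zero
  have hkf : ((k - j).factorial : ℂ) ≠ 0 := by exact_mod_cast (k - j).factorial_ne_zero
  rw [Nat.cast_choose ℂ hj', Nat.factorial_succ j]
  push_cast
  field_simp

open Polynomial in
theorem exists_midpointFunctional (h : HasFactorization χ ε) (hq : q ≠ 0) :
    ∃ L : ℂ[X] →ₗ[ℂ] ℂ, IsMidpointFunctional L (1 / 2 - 1 / q) ε ∧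
      ∀ k, genBernoulli χ (k + 1) / ((k : ℂ) + 1) = (q : ℂ) ^ k * L (X ^ k) := by
  have hq' : (q : ℂ) ≠ 0 := by exact_mod_cast hq
  let L : ℂ[X] →ₗ[ℂ] ℂ := (basisMonomials ℂ).constr ℂ
    fun k => genBernoulli χ (k + 1) / ((k : ℂ) + 1) / (q : ℂ) ^ k
  have hL : ∀ k, L (X ^ k) = genBernoulli χ (k + 1) / ((k : ℂ) + 1) / (q : ℂ) ^ k := by
    intro k
    rw [X_pow_eq_monomial, ← congrFun (coe_basisMonomials ℂ) k, Module.Basis.constr_basis]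
  have hL' : ∀ k, genBernoulli χ (k + 1) / ((k : ℂ) + 1) = (q : ℂ) ^ k * L (X ^ k) := by
    intro k
    rw [hL]; field_simp
  refine ⟨L, ?_, hL'⟩
  -- On monomials this is the recurrence divided by `q^k`. Substituting `X - 1/2` below centres it,
  -- moving `1/q` and `1 - 1/q` to `-s` and `s`.
  have key : ∀ r : ℂ[X], L (r.comp (X + 1) + r) =
      -(r.eval (1 / (q : ℂ)) + ε * r.eval (1 - 1 / (q : ℂ))) := by
    intro r
    induction r using Polynomial.induction_on' with
    | add p r hp hr =>
      rw [add_comp, eval_add, eval_add, add_add_add_comm, map_add, hp, hr]; ring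
    | monomial k c =>
      have h1 := h.recurrence hq k
      have h2 : L ((X + 1) ^ k + X ^ k) =
          -((1 / (q : ℂ)) ^ k + ε * (1 - 1 / (q : ℂ)) ^ k) := by
        apply mul_left_cancel₀ (pow_ne_zero k hq')
        rw [map_add, mul_add, ← hL', add_pow, map_sum, Finset.mul_sum, mul_neg, mul_add,
          mul_left_comm _ ε, ← mul_pow, ← mul_pow, mul_sub, mul_one_div_cancel hq', one_pow,
          mul_one, ← h1]
        congr 1
        refine Finset.sum_congr rfl fun j hj => ?_
        have hj' : j ≤ k := by simpa [Nat.lt_succ_iff] using hj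
        rw [hL', one_pow, mul_one, mul_comm (X ^ j), ← C_eq_natCast, ← smul_eq_C_mul, map_smul,
          smul_eq_mul]
        rw [← pow_sub_mul_pow (q : ℂ) hj']
        ring
      rw [← C_mul_X_pow_eq_monomial, mul_comp, C_comp, X_pow_comp, ← mul_add, ← smul_eq_C_mul,
        map_smul, h2]
      simp only [eval_mul, eval_C, eval_pow, eval_X, smul_eq_mul]
      ring
  intro p
  have h1 := key (p.comp (X - C (1 / 2)))
  have e : (C (1 : ℂ)) - C (1 / 2) = C (1 / 2) := by rw [← C_sub]; norm_num
  rw [comp_assoc, sub_comp, X_comp, C_comp, ← C_1, add_sub_assoc, e, eval_comp, eval_comp] at h1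
  rw [h1]
  simp only [eval_sub, eval_X, eval_C]
  ring_nf

open Polynomial in
theorem bSeq_eq (h : HasFactorization χ ε) (hq : q ≠ 0) (L : ℂ[X] →ₗ[ℂ] ℂ)
    (hL : ∀ k, genBernoulli χ (k + 1) / ((k : ℂ) + 1) = (q : ℂ) ^ k * L (X ^ k)) (x : ℂ) :
    bSeq χ x = fun k => (q : ℂ) ^ k * L ((X + C (x / q)) ^ k) := by
  have hq' : (q : ℂ) ≠ 0 := by exact_mod_cast hq
  ext k
  have hk1 : (k : ℂ) + 1 ≠ 0 := by exact_mod_cast k.succ_ne_zero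
  rw [bSeq, genBernoulliPoly, Finset.sum_range_succ', h.genBernoulli_zero hq]
  simp only [mul_zero, C_0, zero_mul, add_zero, eval_finsetSum, eval_mul, eval_C, eval_pow, eval_X,
    Nat.add_sub_add_right]
  rw [add_pow, map_sum, Finset.mul_sum, Finset.sum_div]
  refine Finset.sum_congr rfl fun j hj => ?_
  have hj' : j ≤ k := by simpa [Nat.lt_succ_iff] using hj
  have hj1 : (j : ℂ) + 1 ≠ 0 := by exact_mod_cast j.succ_ne_zero
  have e : X ^ j * C (x / q) ^ (k - j) * (k.choose j : ℂ[X]) =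
      ((x / q) ^ (k - j) * k.choose j : ℂ) • X ^ j := by
    rw [smul_eq_C_mul, C_mul, C_pow, C_eq_natCast]; ring
  have hB : genBernoulli χ (j + 1) = ((j : ℂ) + 1) * ((q : ℂ) ^ j * L (X ^ j)) := by
    rw [← hL]; field_simp
  have hc : ((k + 1).choose (j + 1) : ℂ) * ((j : ℂ) + 1) = ((k : ℂ) + 1) * k.choose j := by
    exact_mod_cast (Nat.add_one_mul_choose_eq k j).symm
  have hpow : (q : ℂ) ^ k = q ^ (k - j) * q ^ j := by rw [← pow_add, Nat.sub_add_cancel hj']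
  rw [e, map_smul, smul_eq_mul, hB, div_eq_iff hk1, div_pow, hpow]
  field_simp
  linear_combination (L (X ^ j) * x ^ (k - j)) * hc

-- Translation invariance is what makes the determinant independent of `x`.
open Polynomial in
theorem hankelDet_bSeq (h : HasFactorization χ ε) (hq : q ≠ 0) (L : ℂ[X] →ₗ[ℂ] ℂ)
    (hL : ∀ k, genBernoulli χ (k + 1) / ((k : ℂ) + 1) = (q : ℂ) ^ k * L (X ^ k)) (x : ℂ) (n : ℕ) :
    hankelDet (bSeq χ x) n =
      (q : ℂ) ^ ((n + 1) * n) * hankelSizeDet (fun k => L (X ^ k)) (n + 1) := by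
  rw [hankelDet_eq_hankelSizeDet, h.bSeq_eq hq L hL, hankelSizeDet_pow_mul,
    hankelSizeDet_translate, Nat.add_sub_cancel]

end HasFactorization

/-! ### The four characters -/

theorem chiOne_four_hasFactorization : HasFactorization (chiOne 4) (-1) := by
  have hval : ∀ a : ℕ, chiOne 4 (a : ZMod (2 * 4)) = ((chiInt81 (a : ZMod 8) : ℤ) : ℂ) :=
    fun _ => rfl
  have hIcc : Finset.Icc 1 (2 * 4) = ({1, 2, 3, 4, 5, 6, 7, 8} : Finset ℕ) := rfl
  have h2 : chiInt81 ((2 : ℕ) : ZMod 8) = 0 := rfl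
  have h3 : chiInt81 ((3 : ℕ) : ZMod 8) = -1 := rfl
  have h4 : chiInt81 ((4 : ℕ) : ZMod 8) = 0 := rfl
  have h5 : chiInt81 ((5 : ℕ) : ZMod 8) = -1 := rfl
  have h6 : chiInt81 ((6 : ℕ) : ZMod 8) = 0 := rfl
  have h7 : chiInt81 ((7 : ℕ) : ZMod 8) = 1 := rfl
  -- The residue 0 is that of the last summand, `a = 8`.
  have h0 : chiInt81 0 = 0 := rfl
  rw [HasFactorization, hIcc]
  simp only [hval, expSeries_eq_pow]
  simp [h0, h2, h3, h4, h5, h6, h7, -Nat.cast_ofNat]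
  ring

theorem chiTwo_four_hasFactorization : HasFactorization (chiTwo 4) (1) := by
  have hval : ∀ a : ℕ, chiTwo 4 (a : ZMod (2 * 4)) = ((chiInt82 (a : ZMod 8) : ℤ) : ℂ) :=
    fun _ => rfl
  have hIcc : Finset.Icc 1 (2 * 4) = ({1, 2, 3, 4, 5, 6, 7, 8} : Finset ℕ) := rfl
  have h2 : chiInt82 ((2 : ℕ) : ZMod 8) = 0 := rfl
  have h3 : chiInt82 ((3 : ℕ) : ZMod 8) = 1 := rfl
  have h4 : chiInt82 ((4 : ℕ) : ZMod 8) = 0 := rfl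
  have h5 : chiInt82 ((5 : ℕ) : ZMod 8) = -1 := rfl
  have h6 : chiInt82 ((6 : ℕ) : ZMod 8) = 0 := rfl
  have h7 : chiInt82 ((7 : ℕ) : ZMod 8) = -1 := rfl
  have h0 : chiInt82 0 = 0 := rfl
  rw [HasFactorization, hIcc]
  simp only [hval, expSeries_eq_pow]
  simp [h0, h2, h3, h4, h5, h6, h7, -Nat.cast_ofNat]
  ring

theorem chiOne_six_hasFactorization : HasFactorization (chiOne 6) (-1) := by
  have hval : ∀ a : ℕ, chiOne 6 (a : ZMod (2 * 6)) = ((chiInt121 (a : ZMod 12) : ℤ) : ℂ) :=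
    fun _ => rfl
  have hIcc : Finset.Icc 1 (2 * 6) = ({1, 2, 3, 4, 5, 6, 7, 8, 9, 10, 11, 12} : Finset ℕ) := rfl
  have h2 : chiInt121 ((2 : ℕ) : ZMod 12) = 0 := rfl
  have h3 : chiInt121 ((3 : ℕ) : ZMod 12) = 0 := rfl
  have h4 : chiInt121 ((4 : ℕ) : ZMod 12) = 0 := rfl
  have h5 : chiInt121 ((5 : ℕ) : ZMod 12) = -1 := rfl
  have h6 : chiInt121 ((6 : ℕ) : ZMod 12) = 0 := rfl
  have h7 : chiInt121 ((7 : ℕ) : ZMod 12) = -1 := rfl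
  have h8 : chiInt121 ((8 : ℕ) : ZMod 12) = 0 := rfl
  have h9 : chiInt121 ((9 : ℕ) : ZMod 12) = 0 := rfl
  have h10 : chiInt121 ((10 : ℕ) : ZMod 12) = 0 := rfl
  have h11 : chiInt121 ((11 : ℕ) : ZMod 12) = 1 := rfl
  have h0 : chiInt121 0 = 0 := rfl
  rw [HasFactorization, hIcc]
  simp only [hval, expSeries_eq_pow]
  simp [h0, h2, h3, h4, h5, h6, h7, h8, h9, h10, h11, -Nat.cast_ofNat]
  ring

theorem chiTwo_six_hasFactorization : HasFactorization (chiTwo 6) (1) := by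
  have hval : ∀ a : ℕ, chiTwo 6 (a : ZMod (2 * 6)) = ((chiInt122 (a : ZMod 12) : ℤ) : ℂ) :=
    fun _ => rfl
  have hIcc : Finset.Icc 1 (2 * 6) = ({1, 2, 3, 4, 5, 6, 7, 8, 9, 10, 11, 12} : Finset ℕ) := rfl
  have h2 : chiInt122 ((2 : ℕ) : ZMod 12) = 0 := rfl
  have h3 : chiInt122 ((3 : ℕ) : ZMod 12) = 0 := rfl
  have h4 : chiInt122 ((4 : ℕ) : ZMod 12) = 0 := rfl
  have h5 : chiInt122 ((5 : ℕ) : ZMod 12) = 1 := rfl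
  have h6 : chiInt122 ((6 : ℕ) : ZMod 12) = 0 := rfl
  have h7 : chiInt122 ((7 : ℕ) : ZMod 12) = -1 := rfl
  have h8 : chiInt122 ((8 : ℕ) : ZMod 12) = 0 := rfl
  have h9 : chiInt122 ((9 : ℕ) : ZMod 12) = 0 := rfl
  have h10 : chiInt122 ((10 : ℕ) : ZMod 12) = 0 := rfl
  have h11 : chiInt122 ((11 : ℕ) : ZMod 12) = -1 := rfl
  have h0 : chiInt122 0 = 0 := rfl
  rw [HasFactorization, hIcc]
  simp only [hval, expSeries_eq_pow]
  simp [h0, h2, h3, h4, h5, h6, h7, h8, h9, h10, h11, -Nat.cast_ofNat]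
  ring

/-! ### Rearranging the products -/

/-- The factor `f l` occurs once for each `i` from `l` to `m`. -/
theorem prod_range_prod_Icc {R : Type*} [CommMonoid R] (f : ℕ → R) (m : ℕ) :
    ∏ i ∈ Finset.range (m + 1), ∏ l ∈ Finset.Icc 1 i, f l =
      ∏ l ∈ Finset.Icc 1 m, f l ^ (m + 1 - l) := by
  induction m with
  | zero => simp
  | succ m ih =>
    rw [Finset.prod_range_succ, ih, Finset.prod_Icc_succ_top (by omega),
      Finset.prod_Icc_succ_top (by omega), Nat.add_sub_cancel_left, pow_one, ← mul_assoc,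
      ← Finset.prod_mul_distrib]
    congr 1
    refine Finset.prod_congr rfl fun l hl => ?_
    have := (Finset.mem_Icc.mp hl).2
    rw [show m + 1 + 1 - l = m + 1 - l + 1 by omega, pow_succ]

theorem ascPochhammer_half_mul (s : ℂ) (i : ℕ) :
    (ascPochhammer ℂ i).eval (1 / 2 + s) * (ascPochhammer ℂ i).eval (1 / 2 - s) =
      ∏ l ∈ Finset.Icc 1 i, ((2 * (l : ℂ) - 1) ^ 2 / 4 - s ^ 2) := by
  induction i with
  | zero => simp
  | succ i ih =>
    rw [Finset.prod_Icc_succ_top (by omega), ← ih, ascPochhammer_succ_eval,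
      ascPochhammer_succ_eval]
    push_cast
    ring

theorem ascPochhammer_one_mul (s : ℂ) (i : ℕ) :
    (ascPochhammer ℂ i).eval (1 + s) * (ascPochhammer ℂ i).eval (1 - s) =
      ∏ l ∈ Finset.Icc 1 i, ((l : ℂ) ^ 2 - s ^ 2) := by
  induction i with
  | zero => simp
  | succ i ih =>
    rw [Finset.prod_Icc_succ_top (by omega), ← ih, ascPochhammer_succ_eval,
      ascPochhammer_succ_eval]
    push_cast
    ring

/-- The factorials spread as `i!² = ∏ l²` over the inner product, and the squaring hides the sign of
`f`. -/
theorem prod_factorial_sq_mul_prod_sq (f g : ℕ → ℂ) (hfg : ∀ l, f l = -((l : ℂ) ^ 2 * g l))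
    (m : ℕ) :
    (∏ i ∈ Finset.range (m + 1), ((Nat.factorial i : ℂ) ^ 2 * ∏ l ∈ Finset.Icc 1 i, g l)) ^ 2 =
      ∏ l ∈ Finset.Icc 1 m, f l ^ (2 * (m + 1 - l)) := by
  have h : ∀ i : ℕ, (Nat.factorial i : ℂ) ^ 2 * ∏ l ∈ Finset.Icc 1 i, g l =
      ∏ l ∈ Finset.Icc 1 i, ((l : ℂ) ^ 2 * g l) := by
    intro i
    induction i with
    | zero => simp
    | succ i ih =>
      rw [Finset.prod_Icc_succ_top (by omega), Finset.prod_Icc_succ_top (by omega), ← ih,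
        Nat.factorial_succ]
      push_cast
      ring
  simp only [h]
  rw [prod_range_prod_Icc, ← Finset.prod_pow]
  refine Finset.prod_congr rfl fun l _ => ?_
  rw [hfg, pow_mul _ 2, neg_sq, ← pow_mul, ← pow_mul, mul_comm 2]

/-- Source of the `1/m!²`: the shifted product has the same `P` factors but lacks one factorial. -/
theorem prod_factorial_sq_mul_succ (P : ℕ → ℂ) (hP : P 0 = 1) (m : ℕ) :
    ∏ i ∈ Finset.range m, ((Nat.factorial i : ℂ) ^ 2 * P (i + 1)) =
      (∏ i ∈ Finset.range (m + 1), ((Nat.factorial i : ℂ) ^ 2 * P i)) /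
        (Nat.factorial m : ℂ) ^ 2 := by
  have hm : (Nat.factorial m : ℂ) ≠ 0 := by exact_mod_cast m.factorial_ne_zero
  rw [eq_div_iff (pow_ne_zero 2 hm), Finset.prod_mul_distrib, Finset.prod_mul_distrib,
    Finset.prod_range_succ' P, hP, Finset.prod_range_succ]
  ring

theorem prod_mul_prod_succ (t : ℂ) (P : ℕ → ℂ)
    (hP : ∀ i, P i = ∏ l ∈ Finset.Icc 1 i, ((2 * (l : ℂ) - 1) ^ 2 / 4 - (t / 2) ^ 2)) (m : ℕ) :
    (-1) ^ (m + 1) * ((∏ i ∈ Finset.range (m + 1), ((Nat.factorial i : ℂ) ^ 2 * P i)) *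
      ∏ i ∈ Finset.range (m + 1), ((Nat.factorial i : ℂ) ^ 2 * P (i + 1))) =
    (1 / 2) ^ (2 * m + 2) * ∏ l ∈ Finset.Icc 0 m, ((Nat.factorial l : ℂ) ^ 4 / 16 ^ l *
      (t ^ 2 - (2 * (l : ℂ) + 1) ^ 2) ^ (2 * (m - l) + 1)) := by
  have hsucc : ∀ i, P (i + 1) = P i * -((t ^ 2 - (2 * (i : ℂ) + 1) ^ 2) / 4) := by
    intro i
    rw [hP, hP, Finset.prod_Icc_succ_top (by omega)]
    push_cast
    ring
  have hsq : ∀ i, P i ^ 2 =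
      1 / 16 ^ i * ∏ l ∈ Finset.range i, (t ^ 2 - (2 * (l : ℂ) + 1) ^ 2) ^ 2 := by
    intro i
    induction i with
    | zero => simp [hP]
    | succ i ih =>
      rw [hsucc, mul_pow, ih, Finset.prod_range_succ, pow_succ]
      field_simp
      ring
  rw [← Nat.range_succ_eq_Icc_zero]
  induction m with
  | zero => simp [hP]; ring
  | succ m ih =>
    rw [Finset.prod_range_succ _ (m + 1), Finset.prod_range_succ _ (m + 1),
      Finset.prod_range_succ _ (m + 1)]
    have h1 : ∏ l ∈ Finset.range (m + 1), ((Nat.factorial l : ℂ) ^ 4 / 16 ^ l *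
        (t ^ 2 - (2 * (l : ℂ) + 1) ^ 2) ^ (2 * (m + 1 - l) + 1)) =
        (∏ l ∈ Finset.range (m + 1), ((Nat.factorial l : ℂ) ^ 4 / 16 ^ l *
        (t ^ 2 - (2 * (l : ℂ) + 1) ^ 2) ^ (2 * (m - l) + 1))) *
        ∏ l ∈ Finset.range (m + 1), (t ^ 2 - (2 * (l : ℂ) + 1) ^ 2) ^ 2 := by
      rw [← Finset.prod_mul_distrib]
      refine Finset.prod_congr rfl fun l hl => ?_
      have := Finset.mem_range.mp hl
      rw [show 2 * (m + 1 - l) + 1 = 2 * (m - l) + 1 + 2 by omega, pow_add _ _ 2]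
      ring
    have h2 := hsq (m + 1)
    -- Passing from `m` to `m + 1` raises every earlier exponent by 2; these extra squares are
    -- exactly the new `P (m + 1) ^ 2`.
    have h16 : ∏ l ∈ Finset.range (m + 1), (t ^ 2 - (2 * (l : ℂ) + 1) ^ 2) ^ 2 =
        16 ^ (m + 1) * P (m + 1) ^ 2 := by
      rw [h2]; field_simp
    rw [h1, h16, hsucc (m + 1), Nat.sub_self, mul_zero, zero_add, pow_one]
    have h3 : (1 / 2 : ℂ) ^ (2 * (m + 1) + 2) = (1 / 2) ^ (2 * m + 2) / 4 := by
      rw [show 2 * (m + 1) + 2 = 2 * m + 2 + 2 by ring, pow_add _ _ 2]; ring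
    have h4 : (16 : ℂ) ^ (m + 1) * (1 / 16 ^ (m + 1)) = 1 := by field_simp
    rw [h3]
    linear_combination (P (m + 1) ^ 2 * ((m + 1).factorial : ℂ) ^ 4 *
      (t ^ 2 - (2 * ((m + 1 : ℕ) : ℂ) + 1) ^ 2) / 4) * (ih - (1 / 2) ^ (2 * m + 2) *
        (∏ l ∈ Finset.range (m + 1), ((Nat.factorial l : ℂ) ^ 4 / 16 ^ l *
          (t ^ 2 - (2 * (l : ℂ) + 1) ^ 2) ^ (2 * (m - l) + 1))) * h4)

theorem qTilde_div_two {q : ℕ} (hq : q ≠ 0) : (1 / 2 - 1 / q : ℂ) = qTilde q / 2 := by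
  have : (q : ℂ) ≠ 0 := by exact_mod_cast hq
  rw [qTilde]; field_simp

/-! ### Assembling the determinants -/

namespace HasFactorization

variable {q : ℕ} {χ : DirichletCharacter ℂ (2 * q)}

theorem hankelDet_even_eq_zero (h : HasFactorization χ (-1)) (hq : q ≠ 0) (x : ℂ) (m : ℕ) :
    hankelDet (bSeq χ x) (2 * m) = 0 := by
  obtain ⟨L, hL, hb⟩ := h.exists_midpointFunctional hq
  rw [h.hankelDet_bSeq hq L hb, hankelSizeDet_eq_zero_of_odd _ hL.moment_even_eq_zero, mul_zero]

theorem hankelDet_odd (h : HasFactorization χ (-1)) (hq : q ≠ 0) (x : ℂ) (m : ℕ) :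
    hankelDet (bSeq χ x) (2 * m + 1) =
      (-1) ^ (m + 1) * (((q : ℂ) - 2) / 2 * (q : ℂ) ^ (2 * m)) ^ (2 * m + 2) *
        ∏ l ∈ Finset.Icc 1 m,
          ((l : ℂ) ^ 2 / 4 * (qTilde q ^ 2 - (2 * (l : ℂ)) ^ 2)) ^ (2 * (m + 1 - l)) := by
  obtain ⟨L, hL, hb⟩ := h.exists_midpointFunctional hq
  -- The mass `s = q̃/2` enters to the power `2m + 2`, so it merges with one `q` from each of the
  -- `2m + 2` factors `q^(2m+1)`.
  have hs : ((q : ℂ) - 2) / 2 = q * (qTilde q / 2) := by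
    have : (q : ℂ) ≠ 0 := by exact_mod_cast hq
    rw [qTilde]; field_simp
  rw [qTilde_div_two hq] at hL
  rw [h.hankelDet_bSeq hq L hb, show 2 * m + 1 + 1 = 2 * (m + 1) by ring,
    hankelSizeDet_of_odd _ hL.moment_even_eq_zero, hL.hankelSizeDet_moment_odd]
  simp only [ascPochhammer_one_mul]
  rw [mul_pow _ (∏ i ∈ Finset.range (m + 1), _) 2,
    prod_factorial_sq_mul_prod_sq
      (fun l => (l : ℂ) ^ 2 / 4 * (qTilde q ^ 2 - (2 * (l : ℂ)) ^ 2)) _ (fun l => by ring), hs]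
  rw [mul_right_comm (q : ℂ), ← pow_succ', mul_pow _ (qTilde q / 2), ← pow_mul (q : ℂ),
    ← pow_mul (qTilde q / 2)]
  ring

theorem hankelDet_even (h : HasFactorization χ 1) (hq : q ≠ 0) (x : ℂ) (m : ℕ) :
    hankelDet (bSeq χ x) (2 * m) =
      (-1) ^ (m + 1) * ((q : ℂ) ^ (2 * m * (2 * m + 1)) / (Nat.factorial m : ℂ) ^ 2) *
        ∏ l ∈ Finset.Icc 1 m,
          ((l : ℂ) ^ 2 / 4 * (qTilde q ^ 2 - (2 * (l : ℂ) - 1) ^ 2)) ^ (2 * (m + 1 - l)) := by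
  obtain ⟨L, hL, hb⟩ := h.exists_midpointFunctional hq
  rw [qTilde_div_two hq] at hL
  rw [h.hankelDet_bSeq hq L hb,
    -- Among the indices `0, …, 2m` there are `m + 1` even and `m` odd ones.
    hankelSizeDet_of_even _ hL.moment_odd_eq_zero (m + 1) m (2 * m + 1) (by ring) (by omega) le_rfl,
    hL.hankelSizeDet_moment_even, hL.hankelSizeDet_moment_even_add_two]
  simp only [ascPochhammer_half_mul]
  rw [prod_factorial_sq_mul_succ
      (fun i => ∏ l ∈ Finset.Icc 1 i, ((2 * (l : ℂ) - 1) ^ 2 / 4 - (qTilde q / 2) ^ 2)) (by simp),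
    ← prod_factorial_sq_mul_prod_sq
      (fun l => (l : ℂ) ^ 2 / 4 * (qTilde q ^ 2 - (2 * (l : ℂ) - 1) ^ 2))
      (fun l => (2 * (l : ℂ) - 1) ^ 2 / 4 - (qTilde q / 2) ^ 2) (fun l => by ring),
    mul_comm (2 * m + 1)]
  ring

theorem hankelDet_odd' (h : HasFactorization χ 1) (hq : q ≠ 0) (x : ℂ) (m : ℕ) :
    hankelDet (bSeq χ x) (2 * m + 1) =
      (1 / 2 * (q : ℂ) ^ (2 * m + 1)) ^ (2 * m + 2) *
        ∏ l ∈ Finset.Icc 0 m,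
          ((Nat.factorial l : ℂ) ^ 4 / 16 ^ l *
            (qTilde q ^ 2 - (2 * (l : ℂ) + 1) ^ 2) ^ (2 * (m - l) + 1)) := by
  obtain ⟨L, hL, hb⟩ := h.exists_midpointFunctional hq
  rw [qTilde_div_two hq] at hL
  rw [h.hankelDet_bSeq hq L hb,
    hankelSizeDet_of_even _ hL.moment_odd_eq_zero (m + 1) (m + 1) (2 * m + 1 + 1) (by ring) le_rfl
      (by omega), hL.hankelSizeDet_moment_even, hL.hankelSizeDet_moment_even_add_two]
  simp only [ascPochhammer_half_mul]
  rw [mul_pow (1 / 2 : ℂ), mul_right_comm ((1 / 2 : ℂ) ^ _), ← prod_mul_prod_succ (qTilde q)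
    (fun i => ∏ l ∈ Finset.Icc 1 i, ((2 * (l : ℂ) - 1) ^ 2 / 4 - (qTilde q / 2) ^ 2))
    (fun i => rfl), ← pow_mul,
    show (2 * m + 1) * (2 * m + 2) = (2 * m + 1 + 1) * (2 * m + 1) by ring]
  ring

end HasFactorization

theorem corollary4p4 (q : ℕ) (hq : q = 4 ∨ q = 6) (x : ℂ) (m : ℕ) :
    hankelDet (bSeq (chiOne q) x) (2 * m) = 0 ∧
    hankelDet (bSeq (chiOne q) x) (2 * m + 1) =
      (-1) ^ (m + 1) * (((q : ℂ) - 2) / 2 * (q : ℂ) ^ (2 * m)) ^ (2 * m + 2) *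
        ∏ l ∈ Finset.Icc 1 m,
          ((l : ℂ) ^ 2 / 4 * (qTilde q ^ 2 - (2 * (l : ℂ)) ^ 2)) ^ (2 * (m + 1 - l)) ∧
    hankelDet (bSeq (chiTwo q) x) (2 * m) =
      (-1) ^ (m + 1) * ((q : ℂ) ^ (2 * m * (2 * m + 1)) / (Nat.factorial m : ℂ) ^ 2) *
        ∏ l ∈ Finset.Icc 1 m,
          ((l : ℂ) ^ 2 / 4 * (qTilde q ^ 2 - (2 * (l : ℂ) - 1) ^ 2)) ^ (2 * (m + 1 - l)) ∧
    hankelDet (bSeq (chiTwo q) x) (2 * m + 1) =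
      (1 / 2 * (q : ℂ) ^ (2 * m + 1)) ^ (2 * m + 2) *
        ∏ l ∈ Finset.Icc 0 m,
          ((Nat.factorial l : ℂ) ^ 4 / 16 ^ l *
            (qTilde q ^ 2 - (2 * (l : ℂ) + 1) ^ 2) ^ (2 * (m - l) + 1)) := by
  rcases hq with rfl | rfl
  · exact ⟨chiOne_four_hasFactorization.hankelDet_even_eq_zero four_ne_zero x m,
      chiOne_four_hasFactorization.hankelDet_odd four_ne_zero x m,
      chiTwo_four_hasFactorization.hankelDet_even four_ne_zero x m,
      chiTwo_four_hasFactorization.hankelDet_odd' four_ne_zero x m⟩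
  · exact ⟨chiOne_six_hasFactorization.hankelDet_even_eq_zero (by norm_num) x m,
      chiOne_six_hasFactorization.hankelDet_odd (by norm_num) x m,
      chiTwo_six_hasFactorization.hankelDet_even (by norm_num) x m,
      chiTwo_six_hasFactorization.hankelDet_odd' (by norm_num) x m⟩
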